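/- Let $\Sigma$ and $\Gamma$ be finite alphabets, taken disjoint. A finite timed word over an alphabet is a finite sequence of events $(a_0,t_0)\dots(a_k,t_k)$ (possibly empty) with nonnegative real, weakly increasing timestamps; untiming forgets the timestamps. A timed transducer $\mathcal T$ from $\Sigma$ to $\Gamma$ is a timed automaton over $\Sigma\cup\Gamma$ with finitely many locations, clocks and switches, whose guards are finite conjunctions of terms $x\otimes c$ with $c\in\mathbb Q_{\ge 0}$ and $\otimes\in\{<,\le,=,\ge,>\}$. It defines the relation $[\![\mathcal T]\!]$ of all pairs $(w,v)$ of a timed word $w$ over $\Sigma$ and a timed word $v$ over $\Gamma$ such that $\mathcal T$ accepts a timed word $w\oplus v$ formed by merging the events of $w$ and $v$ in order of time (simultaneous events of $w$ and $v$ may come in any order); $\mathrm{unt}([\![\mathcal T]\!])\subseteq\Sigma^*\times\Gamma^*$ is the set of pairs of untimed words obtained from it. The transducer $\mathcal T$ has no cycles labeled by $\Gamma$ if its graph of locations and switches has no cycle all of whose switches carry letters of $\Gamma$. Its size $|\mathcal T|$ counts letters, locations, clocks and switches with their guards, the constants being written in binary. A discrete transducer $\mathcal T^d$ is a nondeterministic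 finite-state transducer with a finite nonempty set of states and a finite set of transitions $(q,a,u,q')$, $a\in\Sigma$, $u\in\Gamma^*$; $[\![\mathcal T^d]\!]\subseteq\Sigma^*\times\Gamma^*$ is the relation of its accepting runs, and its size counts letters, states and transitions with the lengths of their output words. (i) There is a polynomial $p$ such that for every timed transducer $\mathcal T$ that has no cycles labeled by $\Gamma$ there exists a discrete transducer $\mathcal T^d$ of size at most $2^{p(|\mathcal T|)}$ such that $[\![\mathcal T^d]\!]$ and $\mathrm{unt}([\![\mathcal T]\!])$ coincide, except for pairs $(\varepsilon,t)$ with $t\neq\varepsilon$, which a discrete transducer can never produce: $$[\![\mathcal T^d]\!]=\{(s,t)\in\mathrm{unt}([\![\mathcal T]\!]) : s\neq\varepsilon\text{ or }t=\varepsilon\}.$$ (ii) For every discrete transducer $\mathcal T^d$ there exists a timed transducer $\mathcal T$ that has no cycles labeled by $\Gamma$ such that $\mathrm{unt}([\![\mathcal T]\!])=[\![\mathcal T^d]\!]$. -/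

import Mathlib

open scoped NNReal NNRat

namespace TimedTransduction

/-- A finite timed word: events with nonnegative, weakly increasing timestamps. -/
def TimedWord (A : Type*) : Type _ :=
  {w : List (A × ℝ≥0) // (w.map Prod.snd).Pairwise (· ≤ ·)}

/-- The projection of a timed word to its letters. -/
def TimedWord.untimed {A : Type*} (w : TimedWord A) : List A := w.1.map Prod.fst

/-- `u` is a disjoint union of `w` and `v`: the events of `u` are those of `w` and those of `v`,
tagged by the word they come from. Events of `w` and `v` with equal timestamps may appear in `u`
in either order. -/
def IsDisjointUnion {A B : Type*} (w : TimedWord A) (v : TimedWord B) (u : TimedWord (A ⊕ B)) :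
    Prop :=
  u.1.filterMap (fun e => e.1.getLeft?.map (fun a => (a, e.2))) = w.1 ∧
  u.1.filterMap (fun e => e.1.getRight?.map (fun b => (b, e.2))) = v.1

/-- The untiming of a relation on timed words. -/
def untimedRel {A B : Type*} (R : Set (TimedWord A × TimedWord B)) : Set (List A × List B) :=
  {p | ∃ w v, (w, v) ∈ R ∧ p.1 = w.untimed ∧ p.2 = v.untimed}

/-- The comparison symbols of clock constraints. -/
inductive Cmp
  | lt | le | eq | ge | gt

/-- The meaning of a comparison symbol on nonnegative reals. -/
def Cmp.holds : Cmp → ℝ≥0 → ℝ≥0 → Prop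
  | .lt, x, c => x < c
  | .le, x, c => x ≤ c
  | .eq, x, c => x = c
  | .ge, x, c => x ≥ c
  | .gt, x, c => x > c

/-- A term `clock ⋈ const` of a clock constraint. -/
structure Atom (X : Type*) where
  clock : X
  cmp : Cmp
  const : ℚ≥0

/-- A clock constraint: a finite conjunction of atoms (the empty one is true). -/
abbrev Guard (X : Type*) := List (Atom X)

/-- Satisfaction of a clock constraint by a clock valuation. -/
def Guard.Sat {X : Type*} (g : Guard X) (ν : X → ℝ≥0) : Prop :=
  ∀ c ∈ g, c.cmp.holds (ν c.clock) (c.const : ℝ≥0)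

/-- A switch of a timed automaton. -/
structure Switch (S L X : Type*) where
  source : L
  label : S
  guard : Guard X
  resets : Finset X
  target : L

/-- A timed automaton over the alphabet `S` with locations `L` and clocks `X`. -/
structure TimedAutomaton (S L X : Type*) where
  start : L
  switches : Finset (Switch S L X)
  accepting : Finset L

namespace TimedAutomaton

variable {S L X : Type*}

/-- Elapse of `τ` time units in the transition system on states (location, valuation). -/
def Elapse (τ : ℝ≥0) (q q' : L × (X → ℝ≥0)) : Prop :=
  q'.1 = q.1 ∧ ∀ x, q'.2 x = q.2 x + τ

/-- A location switch labelled by `a`. -/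
def Fire (M : TimedAutomaton S L X) (a : S) (q q' : L × (X → ℝ≥0)) : Prop :=
  ∃ s ∈ M.switches, s.source = q.1 ∧ s.label = a ∧ s.target = q'.1 ∧ s.guard.Sat q.2 ∧
    ∀ x, (x ∈ s.resets → q'.2 x = 0) ∧ (x ∉ s.resets → q'.2 x = q.2 x)

/-- Elapse of `τ` time units followed by a location switch labelled by `a`. -/
def Step (M : TimedAutomaton S L X) (τ : ℝ≥0) (a : S) (q q' : L × (X → ℝ≥0)) : Prop :=
  ∃ r, Elapse τ q r ∧ M.Fire a r q'

/-- `M.Run t q w q'`: from state `q` at absolute time `t`, reading the events `w` (with absolute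
timestamps), the automaton can reach state `q'`. -/
inductive Run (M : TimedAutomaton S L X) :
    ℝ≥0 → L × (X → ℝ≥0) → List (S × ℝ≥0) → L × (X → ℝ≥0) → Prop
  | nil (t : ℝ≥0) (q : L × (X → ℝ≥0)) : Run M t q [] q
  | cons {t t' τ : ℝ≥0} {a : S} {q q' q'' : L × (X → ℝ≥0)} {w : List (S × ℝ≥0)} :
      t' = t + τ → M.Step τ a q q' → Run M t' q' w q'' → Run M t q ((a, t') :: w) q''

/-- Acceptance of a timed word, starting at time `0` with all clocks equal to `0`. -/
def Accepts (M : TimedAutomaton S L X) (w : TimedWord S) : Prop :=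
  ∃ q, M.Run 0 (M.start, fun _ => 0) w.1 q ∧ q.1 ∈ M.accepting

end TimedAutomaton

/-- A timed transducer with input alphabet `A` and output alphabet `B`: a timed automaton whose
alphabet is partitioned into `A` and `B`. -/
abbrev TimedTransducer (A B L X : Type*) := TimedAutomaton (A ⊕ B) L X

namespace TimedTransducer

variable {A B L X : Type*}

/-- The relation on timed words defined by a timed transducer. -/
def relation (T : TimedTransducer A B L X) : Set (TimedWord A × TimedWord B) :=
  {p | ∃ u, IsDisjointUnion p.1 p.2 u ∧ T.Accepts u}

/-- There is an output-labelled switch from `l` to `l'`. -/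
def OutEdge (T : TimedTransducer A B L X) (l l' : L) : Prop :=
  ∃ s ∈ T.switches, s.source = l ∧ s.target = l' ∧ ∃ b : B, s.label = Sum.inr b

/-- No cycle, in the graph of locations and switches, consists of output-labelled switches only. -/
def NoOutputCycle (T : TimedTransducer A B L X) : Prop :=
  ∀ l, ¬ Relation.TransGen T.OutEdge l l

/-- The number of symbols needed to write down a clock constraint, with constants in binary. -/
def guardSize (g : Guard X) : ℕ :=
  (g.map fun c => 2 + (Nat.size c.const.num + Nat.size c.const.den)).sum

/-- The size of a timed transducer, with the constants of the guards in binary. -/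
def size [Fintype A] [Fintype B] [Fintype L] [Fintype X] (T : TimedTransducer A B L X) : ℕ :=
  Fintype.card A + Fintype.card B + Fintype.card L + Fintype.card X + 1 + T.accepting.card +
    ∑ s ∈ T.switches, (3 + guardSize s.guard + s.resets.card)

end TimedTransducer

/-- A discrete (nondeterministic) finite-state transducer with states `Q`: each transition
`(q, a, w, q')` reads one input letter `a` and writes a word `w`. -/
structure DiscreteTransducer (A B Q : Type*) where
  initial : Finset Q
  transitions : Finset (Q × A × List B × Q)
  accepting : Finset Q

namespace DiscreteTransducer

variable {A B Q : Type*}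

/-- `D.Run q s t q'`: there is a run from `q` to `q'` on the input `s` with output `t`. -/
inductive Run (D : DiscreteTransducer A B Q) : Q → List A → List B → Q → Prop
  | nil (q : Q) : Run D q [] [] q
  | cons {q q' q'' : Q} {a : A} {w : List B} {s : List A} {t : List B} :
      (q, a, w, q') ∈ D.transitions → Run D q' s t q'' → Run D q (a :: s) (w ++ t) q''

/-- The relation on words defined by a discrete transducer. -/
def relation (D : DiscreteTransducer A B Q) : Set (List A × List B) :=
  {p | ∃ q ∈ D.initial, ∃ q' ∈ D.accepting, D.Run q p.1 p.2 q'}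

/-- The size of a discrete transducer: alphabets, states, and the total length of all transitions. -/
def size [Fintype A] [Fintype B] [Fintype Q] (D : DiscreteTransducer A B Q) : ℕ :=
  Fintype.card A + Fintype.card B + Fintype.card Q + D.initial.card + D.accepting.card +
    ∑ e ∈ D.transitions, (3 + e.2.2.1.length)

end DiscreteTransducer

end TimedTransduction

/-!
Merging with timestamps is invisible after untiming: the untimed relation of a timed transducer
consists of the pairs of projections of the words accepted by the nondeterministic automaton whose
states are pairs of a location and a clock valuation, and whose steps let an arbitrary delay pass.

After scaling, all constants are natural numbers at most `M`. Add a clock that is constantly zero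
and remember, besides the location, only the position of each difference of two clocks relative to
the integers between `-M` and `M`. A reset identifies a clock with the zero clock. A delay `t` is
matched by a delay `t'` that lies among the points `n - a x` as `t` does; the order type of these
points is determined by the differences of clocks, and density of the reals provides `t'`. Hence
forgetting everything else is a functional bisimulation onto a finite automaton with exponentially
many states. If no cycle is labeled by output letters, then runs of output letters are no longer
than the number of locations, so the output around each input letter fits into one transition of a
discrete transducer.

Conversely, a discrete transducer that writes its output words letter by letter is a finite
automaton, that is, a timed automaton without clocks, and the length of the pending output decreases
along every output switch.
-/

namespace TimedTransduction

open Set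

section Words

variable {A B : Type*}

/-- The input letters of an interleaving of an input word with an output word. -/
def inputs (z : List (A ⊕ B)) : List A := z.filterMap Sum.getLeft?

/-- The output letters of an interleaving of an input word with an output word. -/
def outputs (z : List (A ⊕ B)) : List B := z.filterMap Sum.getRight?

@[simp] theorem inputs_inl_cons (a : A) (z : List (A ⊕ B)) :
    inputs (.inl a :: z) = a :: inputs z := rfl

@[simp] theorem inputs_inr_cons (b : B) (z : List (A ⊕ B)) : inputs (.inr b :: z) = inputs z := rfl

@[simp] theorem outputs_inl_cons (a : A) (z : List (A ⊕ B)) :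
    outputs (.inl a :: z) = outputs z := rfl

@[simp] theorem outputs_inr_cons (b : B) (z : List (A ⊕ B)) :
    outputs (.inr b :: z) = b :: outputs z := rfl

@[simp] theorem inputs_append (z₁ z₂ : List (A ⊕ B)) :
    inputs (z₁ ++ z₂) = inputs z₁ ++ inputs z₂ := List.filterMap_append

@[simp] theorem outputs_append (z₁ z₂ : List (A ⊕ B)) :
    outputs (z₁ ++ z₂) = outputs z₁ ++ outputs z₂ := List.filterMap_append

@[simp] theorem inputs_map_inr (u : List B) : inputs (u.map (.inr : B → A ⊕ B)) = [] := by
  simp [inputs]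

@[simp] theorem outputs_map_inr (u : List B) : outputs (u.map (.inr : B → A ⊕ B)) = u := by
  simp [outputs, List.filterMap_map, Function.comp_def]

theorem map_inr_outputs_of_inputs_eq_nil {z : List (A ⊕ B)} (hz : inputs z = []) :
    (outputs z).map .inr = z := by
  induction z with
  | nil => rfl
  | cons c z ih =>
    rcases c with a | b
    · simp at hz
    · simpa using ih hz

/-- The timed word of the images under `f` of the events with a letter in the domain of `f`. -/
def TimedWord.filterMap (f : A → Option B) (u : TimedWord A) : TimedWord B :=
  ⟨u.1.filterMap fun e => (f e.1).map fun b => (b, e.2), by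
    have hu := u.2
    rw [List.pairwise_map] at hu ⊢
    rw [List.pairwise_filterMap]
    refine hu.imp fun h x hx y hy => ?_
    obtain ⟨_, -, rfl⟩ := Option.map_eq_some_iff.1 hx
    obtain ⟨_, -, rfl⟩ := Option.map_eq_some_iff.1 hy
    exact h⟩

theorem TimedWord.untimed_filterMap (f : A → Option B) (u : TimedWord A) :
    (u.filterMap f).untimed = u.untimed.filterMap f := by
  simp [TimedWord.untimed, TimedWord.filterMap, List.map_filterMap, List.filterMap_map,
    Function.comp_def]

theorem isDisjointUnion_iff {w : TimedWord A} {v : TimedWord B} {u : TimedWord (A ⊕ B)} :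
    IsDisjointUnion w v u ↔
      u.filterMap Sum.getLeft? = w ∧ u.filterMap Sum.getRight? = v :=
  ⟨fun h => ⟨Subtype.ext h.1, Subtype.ext h.2⟩,
    fun h => ⟨congrArg Subtype.val h.1, congrArg Subtype.val h.2⟩⟩

/-- The relation between input and output words encoded by a language over the disjoint union of
the alphabets. -/
def wordRel (K : Language (A ⊕ B)) : Set (List A × List B) :=
  (fun z => (inputs z, outputs z)) '' K

end Words

section FunctionalBisimulation

variable {S P Q : Type*} {M : NFA S P} {N : NFA S Q} {f : P → Q}

/-- `f` is a functional bisimulation (bounded morphism) from `M` to `N`: the moves of `N` from `f p`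
are exactly the images of the moves of `M` from `p`. -/
structure IsFunctionalBisimulation (M : NFA S P) (N : NFA S Q) (f : P → Q) : Prop where
  image_start : f '' M.start = N.start
  image_step : ∀ p a, f '' M.step p a = N.step (f p) a
  preimage_accept : f ⁻¹' N.accept = M.accept

theorem IsFunctionalBisimulation.image_evalFrom (h : IsFunctionalBisimulation M N f) (s : Set P)
    (z : List S) : f '' M.evalFrom s z = N.evalFrom (f '' s) z := by
  induction z generalizing s with
  | nil => rfl
  | cons a z ih =>
    simp only [NFA.evalFrom_cons, ih, NFA.stepSet, image_iUnion₂, h.image_step, biUnion_image]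

theorem IsFunctionalBisimulation.accepts_eq (h : IsFunctionalBisimulation M N f) :
    M.accepts = N.accepts := by
  ext z
  rw [NFA.mem_accepts, NFA.mem_accepts, ← h.image_start, ← h.image_evalFrom, ← h.preimage_accept]
  constructor
  · rintro ⟨p, hp, hpz⟩
    exact ⟨f p, hp, mem_image_of_mem f hpz⟩
  · rintro ⟨_, hp, p, hpz, rfl⟩
    exact ⟨p, hp, hpz⟩

/-- The image of an automaton under a map of its states. -/
def pushforward (M : NFA S P) (f : P → Q) : NFA S Q where
  step q a := {q' | ∃ p, f p = q ∧ q' ∈ f '' M.step p a}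
  start := f '' M.start
  accept := f '' M.accept

theorem isFunctionalBisimulation_pushforward
    (hstep : ∀ p₁ p₂ a, f p₁ = f p₂ → f '' M.step p₁ a ⊆ f '' M.step p₂ a)
    (haccept : ∀ p₁ p₂, f p₁ = f p₂ → p₁ ∈ M.accept → p₂ ∈ M.accept) :
    IsFunctionalBisimulation M (pushforward M f) f where
  image_start := rfl
  image_step p a := Subset.antisymm (fun _ h => ⟨p, rfl, h⟩)
    fun _ ⟨p₁, h₁, h⟩ => hstep p₁ p a h₁ h
  preimage_accept := Subset.antisymm (fun p ⟨p₁, h₁, h⟩ => haccept p₁ p h h₁)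
    (subset_preimage_image f _)

/-- The inverse image of an automaton under a map to its states. -/
def pullback (N : NFA S Q) (f : P → Q) : NFA S P where
  step p a := f ⁻¹' N.step (f p) a
  start := f ⁻¹' N.start
  accept := f ⁻¹' N.accept

theorem isFunctionalBisimulation_pullback (hstart : N.start ⊆ range f)
    (hstep : ∀ p a, N.step (f p) a ⊆ range f) :
    IsFunctionalBisimulation (pullback N f) N f where
  image_start := image_preimage_eq_of_subset hstart
  image_step p a := image_preimage_eq_of_subset (hstep p a)
  preimage_accept := rfl

end FunctionalBisimulation

section Untiming

variable {S A B L X : Type*}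

/-- The automaton of the states of a timed automaton and its steps with arbitrary delay. -/
def TimedAutomaton.untimedNFA (T : TimedAutomaton S L X) : NFA S (L × (X → ℝ≥0)) where
  step q a := {q' | ∃ τ, T.Step τ a q q'}
  start := {(T.start, fun _ => 0)}
  accept := {q | q.1 ∈ T.accepting}

theorem TimedAutomaton.Run.le_timestamp {T : TimedAutomaton S L X} {t : ℝ≥0}
    {q q' : L × (X → ℝ≥0)} {u : List (S × ℝ≥0)} (h : T.Run t q u q') : ∀ e ∈ u, t ≤ e.2 := by
  induction h with
  | nil => simp
  | cons ht _ _ ih =>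
    subst ht
    exact List.forall_mem_cons.2 ⟨le_self_add, fun e he => le_self_add.trans (ih e he)⟩

theorem TimedAutomaton.Run.pairwise_timestamps {T : TimedAutomaton S L X} {t : ℝ≥0}
    {q q' : L × (X → ℝ≥0)} {u : List (S × ℝ≥0)} (h : T.Run t q u q') :
    (u.map Prod.snd).Pairwise (· ≤ ·) := by
  induction h with
  | nil => simp
  | cons _ _ hrun ih =>
    exact List.pairwise_cons.2 ⟨List.forall_mem_map.2 hrun.le_timestamp, ih⟩

theorem TimedAutomaton.mem_evalFrom_untimedNFA_iff {T : TimedAutomaton S L X}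
    {q q' : L × (X → ℝ≥0)} {z : List S} (t : ℝ≥0) :
    q' ∈ T.untimedNFA.evalFrom {q} z ↔ ∃ u, T.Run t q u q' ∧ u.map Prod.fst = z := by
  constructor
  · intro h
    induction z generalizing t q with
    | nil => exact ⟨[], mem_singleton_iff.1 h ▸ .nil t q', rfl⟩
    | cons a z ih =>
      rw [NFA.evalFrom_cons, NFA.stepSet_singleton, NFA.mem_evalFrom_iff_exists] at h
      obtain ⟨r, ⟨τ, hstep⟩, hr⟩ := h
      obtain ⟨u, hu, rfl⟩ := ih (t + τ) hr
      exact ⟨(a, t + τ) :: u, .cons rfl hstep hu, rfl⟩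
  · rintro ⟨u, hrun, rfl⟩
    induction hrun with
    | nil => rfl
    | cons _ hstep _ ih =>
      rw [List.map_cons, NFA.evalFrom_cons, NFA.stepSet_singleton, NFA.mem_evalFrom_iff_exists]
      exact ⟨_, ⟨_, hstep⟩, ih⟩

theorem TimedAutomaton.mem_accepts_untimedNFA_iff {T : TimedAutomaton S L X} {z : List S} :
    z ∈ T.untimedNFA.accepts ↔ ∃ u, T.Accepts u ∧ u.untimed = z := by
  rw [NFA.mem_accepts]
  constructor
  · rintro ⟨q, hq, hz⟩
    obtain ⟨u, hu, hz⟩ := (mem_evalFrom_untimedNFA_iff 0).1 hz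
    exact ⟨⟨u, hu.pairwise_timestamps⟩, ⟨q, hu, hq⟩, hz⟩
  · rintro ⟨u, ⟨q, hu, hq⟩, hz⟩
    exact ⟨q, hq, (mem_evalFrom_untimedNFA_iff 0).2 ⟨u.1, hu, hz⟩⟩

theorem untimedRel_relation_eq_wordRel (T : TimedTransducer A B L X) :
    untimedRel T.relation = wordRel T.untimedNFA.accepts := by
  ext ⟨s, t⟩
  constructor
  · rintro ⟨w, v, ⟨u, hu, hacc⟩, rfl, rfl⟩
    obtain ⟨rfl, rfl⟩ := isDisjointUnion_iff.1 hu
    refine ⟨u.untimed, TimedAutomaton.mem_accepts_untimedNFA_iff.2 ⟨u, hacc, rfl⟩, ?_⟩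
    simp only [TimedWord.untimed_filterMap]
    rfl
  · rintro ⟨z, hz, hst⟩
    obtain ⟨u, hacc, rfl⟩ := TimedAutomaton.mem_accepts_untimedNFA_iff.1 hz
    obtain ⟨rfl, rfl⟩ := Prod.ext_iff.1 hst
    exact ⟨u.filterMap Sum.getLeft?, u.filterMap Sum.getRight?,
      ⟨u, isDisjointUnion_iff.2 ⟨rfl, rfl⟩, hacc⟩, (u.untimed_filterMap _).symm,
      (u.untimed_filterMap _).symm⟩

end Untiming

section Regions

/-- The position of a real number relative to the integers of absolute value at most `M`: the even
code `2 * c` stands for the point `c`, the odd codes for the open intervals between neighbouring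
points and for the two unbounded intervals. -/
noncomputable def position (M : ℕ) (r : ℝ) : Icc (-(2 * M + 1) : ℤ) (2 * M + 1) :=
  projIcc _ _ (by omega) (⌊r⌋ + ⌈r⌉)

variable {M : ℕ} {r s : ℝ}

theorem cmp_intCast_eq_cmp_position {c : ℤ} (hc : c.natAbs ≤ M) :
    cmp r c = cmp (position M r : ℤ) (2 * c) := by
  have hfloor : r < c ↔ ⌊r⌋ < c := Int.floor_lt.symm
  have hceil : (c : ℝ) < r ↔ c < ⌈r⌉ := Int.lt_ceil.symm
  have h₁ := Int.floor_le_ceil r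
  have h₂ := Int.ceil_le_floor_add_one r
  have hlt : r < c ↔ (position M r : ℤ) < 2 * c := by
    rw [hfloor, position, coe_projIcc]; omega
  have hgt : (c : ℝ) < r ↔ 2 * c < (position M r : ℤ) := by
    rw [hceil, position, coe_projIcc]; omega
  simp only [cmp, cmpUsing, hlt, hgt]

theorem position_eq_iff :
    position M r = position M s ↔ ∀ c : ℤ, c.natAbs ≤ M → cmp r c = cmp s c := by
  constructor
  · intro h c hc
    rw [cmp_intCast_eq_cmp_position hc, h, ← cmp_intCast_eq_cmp_position hc]
  · suffices hle : ∀ {r s : ℝ}, (∀ c : ℤ, c.natAbs ≤ M → cmp r c = cmp s c) →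
        position M r ≤ position M s from
      fun h => (hle h).antisymm (hle fun c hc => (h c hc).symm)
    intro r s h
    by_contra! hlt
    have hlt : (position M s : ℤ) < position M r := hlt
    have hr := (position M r).2.2
    have hs := (position M s).2.1
    -- `(p + 1) / 2` is the least integer whose even code is at least `p`.
    have hc : ((position M s + 1 : ℤ) / 2).natAbs ≤ M := by omega
    have hcmp := h _ hc
    rw [cmp_intCast_eq_cmp_position hc, cmp_intCast_eq_cmp_position hc] at hcmp
    have h_lt := lt_iff_lt_of_cmp_eq_cmp hcmp
    have h_eq := eq_iff_eq_of_cmp_eq_cmp hcmp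
    omega

theorem position_eq_iff_of_nonneg (hr : 0 ≤ r) (hs : 0 ≤ s) :
    position M r = position M s ↔ ∀ n : ℕ, n ≤ M → cmp r n = cmp s n := by
  rw [position_eq_iff]
  constructor
  · intro h n hn
    exact_mod_cast h n hn
  · intro h c hc
    rcases le_or_gt 0 c with hc₀ | hc₀
    · lift c to ℕ using hc₀
      exact_mod_cast h c hc
    · have hc₀ : (c : ℝ) < 0 := by exact_mod_cast hc₀
      rw [(cmp_eq_gt_iff _ _).2 (hc₀.trans_le hr), (cmp_eq_gt_iff _ _).2 (hc₀.trans_le hs)]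

theorem coe_position_neg (M : ℕ) (r : ℝ) : (position M (-r) : ℤ) = -position M r := by
  simp only [position, coe_projIcc, Int.floor_neg, Int.ceil_neg]
  omega

theorem exists_cmp_eq {ι α β : Type*} [Finite ι] [LinearOrder α] [LinearOrder β] [DenselyOrdered β]
    [NoMinOrder β] [NoMaxOrder β] [Nonempty β] {f : ι → α} {g : ι → β}
    (h : ∀ i j, cmp (f i) (f j) = cmp (g i) (g j)) (a : α) :
    ∃ b, ∀ i, cmp (f i) a = cmp (g i) b := by
  obtain ⟨b, hb⟩ := Order.PartialIso.exists_across
    ⟨(finite_range fun i => (f i, g i)).toFinset, by simpa using h⟩ a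
  exact ⟨b, fun i => hb (f i, g i) (by simpa using ⟨i, rfl, rfl⟩)⟩

variable {Y Z : Type*}

/-- The region of a valuation: the positions, up to the precision `M`, of the differences of any two
clocks. -/
noncomputable def region (M : ℕ) (a : Y → ℝ) : Y × Y → Icc (-(2 * M + 1) : ℤ) (2 * M + 1) :=
  fun p => position M (a p.1 - a p.2)

theorem position_sub_eq_of_region_eq {a b : Y → ℝ} (h : region M a = region M b) (x y : Y) :
    position M (a x - a y) = position M (b x - b y) :=
  congrFun h (x, y)

theorem cmp_sub_intCast_of_region_eq {a b : Y → ℝ} (h : region M a = region M b) (x y : Y) {c : ℤ}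
    (hc : c.natAbs ≤ M) : cmp (a x - a y) c = cmp (b x - b y) c :=
  position_eq_iff.1 (position_sub_eq_of_region_eq h x y) c hc

theorem region_comp_congr {a b : Y → ℝ} (h : region M a = region M b) (ρ : Z → Y) :
    region M (a ∘ ρ) = region M (b ∘ ρ) :=
  funext fun p => position_sub_eq_of_region_eq h (ρ p.1) (ρ p.2)

theorem exists_cmp_add_eq_of_region_eq [Finite Y] {a b : Y → ℝ} (h : region M a = region M b)
    (t : ℝ) : ∃ t', ∀ x, ∀ n ≤ M, cmp (a x + t) n = cmp (b x + t') n := by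
  have hpoints (i j : Y × Fin (M + 1)) :
      cmp (i.2 - a i.1 : ℝ) (j.2 - a j.1) = cmp (i.2 - b i.1 : ℝ) (j.2 - b j.1) := by
    have hshift (c : Y → ℝ) : cmp (i.2 - c i.1 : ℝ) (j.2 - c j.1) =
        cmp (c j.1 - c i.1) ((j.2 - i.2 : ℤ) : ℝ) := by
      rw [← cmp_add_right _ _ (c j.1 - i.2 : ℝ)]
      congr 1 <;> push_cast <;> ring
    rw [hshift, hshift]
    exact cmp_sub_intCast_of_region_eq h j.1 i.1 (by omega)
  -- Moving all clocks by `t` amounts to placing `t` among the finitely many points `n - a x`.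
  obtain ⟨t', ht'⟩ := exists_cmp_eq hpoints t
  refine ⟨t', fun x n hn => cmp_eq_cmp_symm.1 ?_⟩
  have hshift (c : Y → ℝ) (u : ℝ) : cmp (n : ℝ) (c x + u) = cmp (n - c x : ℝ) u := by
    rw [← cmp_add_right (n - c x : ℝ) u (c x), sub_add_cancel, add_comm u]
  rw [hshift, hshift]
  exact ht' (x, ⟨n, Nat.lt_succ_of_le hn⟩)

variable {X : Type*} {d : ℕ} {ν μ : X → ℝ≥0}

/-- A clock valuation in units of `1 / d`, with an additional clock `none` that is constantly zero:
the values of the clocks are themselves differences of clocks. -/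
noncomputable def scaled (d : ℕ) (ν : X → ℝ≥0) : Option X → ℝ :=
  fun o => o.elim 0 fun x => d * ν x

theorem scaled_nonneg (d : ℕ) (ν : X → ℝ≥0) (o : Option X) : 0 ≤ scaled d ν o := by
  cases o with
  | none => exact le_rfl
  | some x => exact mul_nonneg d.cast_nonneg (ν x).coe_nonneg

theorem region_scaled_add_congr (h : region M (scaled d ν) = region M (scaled d μ)) {τ τ' : ℝ≥0}
    (hvalue : ∀ x, position M (scaled d (fun x => ν x + τ) (some x)) =
      position M (scaled d (fun x => μ x + τ') (some x))) :
    region M (scaled d fun x => ν x + τ) = region M (scaled d fun x => μ x + τ') := by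
  have hdiff (κ : X → ℝ≥0) (σ : ℝ≥0) (x y : X) :
      scaled d (fun x => κ x + σ) (some x) - scaled d (fun x => κ x + σ) (some y) =
        scaled d κ (some x) - scaled d κ (some y) := by
    simp only [scaled, Option.elim_some, NNReal.coe_add]; ring
  funext ⟨o, o'⟩
  cases o with
  | none =>
    cases o' with
    | none => rfl
    | some y =>
      simp only [region, scaled, Option.elim_none, zero_sub, Subtype.ext_iff, coe_position_neg]
      exact congrArg Neg.neg (congrArg Subtype.val (hvalue y))
  | some x =>
    cases o' with
    | none => simpa only [region, scaled, Option.elim_none, sub_zero] using hvalue x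
    | some y =>
      simp only [region, hdiff]
      exact position_sub_eq_of_region_eq h (some x) (some y)

theorem exists_region_scaled_add_eq [Finite X] (hd : 0 < d)
    (h : region M (scaled d ν) = region M (scaled d μ)) (τ : ℝ≥0) :
    ∃ τ' : ℝ≥0,
      region M (scaled d fun x => ν x + τ) = region M (scaled d fun x => μ x + τ') := by
  obtain ⟨t, ht⟩ := exists_cmp_add_eq_of_region_eq h (d * τ)
  have ht₀ : 0 ≤ t := by
    have hcmp := ht none 0 M.zero_le
    simp only [scaled, Option.elim_none, zero_add, Nat.cast_zero] at hcmp
    exact (le_iff_le_of_cmp_eq_cmp (cmp_eq_cmp_symm.1 hcmp)).1 (by positivity)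
  lift t to ℝ≥0 using ht₀
  have hd₀ : (d : ℝ) ≠ 0 := by positivity
  refine ⟨t / d, region_scaled_add_congr h fun x => ?_⟩
  rw [position_eq_iff_of_nonneg (scaled_nonneg ..) (scaled_nonneg ..)]
  intro n hn
  convert ht (some x) n hn using 2
  · simp only [scaled, Option.elim_some, NNReal.coe_add, mul_add]
  · simp only [scaled, Option.elim_some, NNReal.coe_add, NNReal.coe_div, NNReal.coe_natCast,
      mul_add, mul_div_cancel₀ _ hd₀]

theorem scaled_indicator_compl (d : ℕ) (s : Set X) [DecidablePred (· ∈ s)] (ν : X → ℝ≥0) :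
    scaled d (sᶜ.indicator ν) =
      scaled d ν ∘ fun o => o.bind fun x => if x ∈ s then none else some x := by
  funext o
  cases o with
  | none => rfl
  | some x => by_cases hx : x ∈ s <;> simp [scaled, hx]

theorem region_scaled_indicator_congr (h : region M (scaled d ν) = region M (scaled d μ))
    (s : Set X) :
    region M (scaled d (sᶜ.indicator ν)) = region M (scaled d (sᶜ.indicator μ)) := by
  classical
  rw [scaled_indicator_compl, scaled_indicator_compl]
  exact region_comp_congr h _

end Regions

section RegionAutomaton

variable {S L X : Type*} {T : TimedAutomaton S L X} {d M : ℕ}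

/-- In units of `1 / d`, every constant of `T` is a natural number that is at most `M`. -/
structure IsScale (T : TimedAutomaton S L X) (d M : ℕ) : Prop where
  pos : 0 < d
  exists_nat : ∀ s ∈ T.switches, ∀ c ∈ s.guard, ∃ n ≤ M, (d : ℝ≥0) * (c.const : ℝ≥0) = n

theorem Cmp.holds_congr {k : Cmp} {x y c e : ℝ≥0} (h : cmp x c = cmp y e) :
    k.holds x c ↔ k.holds y e := by
  cases k with
  | lt => exact lt_iff_lt_of_cmp_eq_cmp h
  | le => exact le_iff_le_of_cmp_eq_cmp h
  | eq => exact eq_iff_eq_of_cmp_eq_cmp h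
  | ge => exact le_iff_le_of_cmp_eq_cmp (cmp_eq_cmp_symm.1 h)
  | gt => exact lt_iff_lt_of_cmp_eq_cmp (cmp_eq_cmp_symm.1 h)

theorem IsScale.cmp_const_congr (hT : IsScale T d M) {ν μ : X → ℝ≥0}
    (h : region M (scaled d ν) = region M (scaled d μ)) {s : Switch S L X} (hs : s ∈ T.switches)
    {c : Atom X} (hc : c ∈ s.guard) :
    cmp (ν c.clock) (c.const : ℝ≥0) = cmp (μ c.clock) (c.const : ℝ≥0) := by
  obtain ⟨n, hn, hcn⟩ := hT.exists_nat s hs c hc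
  have hscale (κ : X → ℝ≥0) :
      cmp (κ c.clock) (c.const : ℝ≥0) =
        cmp (scaled d κ (some c.clock) - scaled d κ none) (n : ℤ) := by
    rw [← cmp_mul_pos_left (Nat.cast_pos.2 hT.pos : (0 : ℝ≥0) < d), hcn,
      ← StrictMono.cmp_map_eq (f := NNReal.toReal) fun _ _ => NNReal.coe_lt_coe.2]
    simp only [scaled, Option.elim_some, Option.elim_none, sub_zero, NNReal.coe_mul,
      NNReal.coe_natCast, Int.cast_natCast]
  rw [hscale, hscale]
  exact cmp_sub_intCast_of_region_eq h _ _ (by omega)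

theorem IsScale.sat_congr (hT : IsScale T d M) {ν μ : X → ℝ≥0}
    (h : region M (scaled d ν) = region M (scaled d μ)) {s : Switch S L X} (hs : s ∈ T.switches) :
    s.guard.Sat ν ↔ s.guard.Sat μ :=
  forall₂_congr fun _ hc => Cmp.holds_congr (hT.cmp_const_congr h hs hc)

/-- The states of the region automaton: a location together with a region of the clocks `X` and the
additional clock `none`. -/
abbrev RegionState (L X : Type*) (M : ℕ) : Type _ :=
  L × (Option X × Option X → Icc (-(2 * M + 1) : ℤ) (2 * M + 1))

/-- The state of the region automaton that represents a state of the timed automaton. -/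
noncomputable def regionState (d M : ℕ) (q : L × (X → ℝ≥0)) : RegionState L X M :=
  (q.1, region M (scaled d q.2))

theorem card_regionState (L X : Type*) [Finite X] (M : ℕ) :
    Nat.card (RegionState L X M) =
      Nat.card L * (4 * M + 3) ^ ((Nat.card X + 1) * (Nat.card X + 1)) := by
  have hIcc : Nat.card (Icc (-(2 * M + 1) : ℤ) (2 * M + 1)) = 4 * M + 3 := by
    rw [Nat.card_eq_fintype_card, Fintype.card_Icc, Int.card_Icc]
    omega
  rw [Nat.card_prod, Nat.card_fun, Nat.card_prod, Finite.card_option, hIcc]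

theorem exists_elapse_of_regionState_eq [Finite X] (hd : 0 < d) {p q p' : L × (X → ℝ≥0)} {τ : ℝ≥0}
    (h : regionState d M p = regionState d M q) (hp : TimedAutomaton.Elapse τ p p') :
    ∃ τ' q', TimedAutomaton.Elapse τ' q q' ∧ regionState d M q' = regionState d M p' := by
  obtain ⟨hloc, hreg⟩ := Prod.ext_iff.1 h
  obtain ⟨τ', hτ'⟩ := exists_region_scaled_add_eq hd hreg τ
  refine ⟨τ', (q.1, fun x => q.2 x + τ'), ⟨rfl, fun _ => rfl⟩, ?_⟩
  have hp' : p' = (p.1, fun x => p.2 x + τ) := Prod.ext hp.1 (funext hp.2)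
  rw [hp']
  exact Prod.ext hloc.symm hτ'.symm

theorem IsScale.exists_fire_of_regionState_eq (hT : IsScale T d M) {p q p' : L × (X → ℝ≥0)} {a : S}
    (h : regionState d M p = regionState d M q) (hp : T.Fire a p p') :
    ∃ q', T.Fire a q q' ∧ regionState d M q' = regionState d M p' := by
  classical
  obtain ⟨hloc, hreg⟩ := Prod.ext_iff.1 h
  obtain ⟨s, hs, hsource, hlabel, htarget, hsat, hreset⟩ := hp
  refine ⟨(p'.1, (s.resets : Set X)ᶜ.indicator q.2), ⟨s, hs, hsource.trans hloc, hlabel, htarget,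
    (hT.sat_congr hreg hs).1 hsat, fun x => ⟨fun hx => ?_, fun hx => ?_⟩⟩, ?_⟩
  · simp [hx]
  · simp [hx]
  · have hp' : p'.2 = (s.resets : Set X)ᶜ.indicator p.2 := by
      funext x
      by_cases hx : x ∈ s.resets
      · simp [hx, (hreset x).1 hx]
      · simp [hx, (hreset x).2 hx]
    refine Prod.ext rfl ?_
    simp only [regionState, hp']
    exact (region_scaled_indicator_congr hreg _).symm

/-- The region automaton of `T` at the scale `d`, `M`. -/
noncomputable def regionNFA (T : TimedAutomaton S L X) (d M : ℕ) : NFA S (RegionState L X M) :=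
  pushforward T.untimedNFA (regionState d M)

theorem IsScale.isFunctionalBisimulation_regionState [Finite X] (hT : IsScale T d M) :
    IsFunctionalBisimulation T.untimedNFA (regionNFA T d M) (regionState d M) := by
  refine isFunctionalBisimulation_pushforward ?_ ?_
  · rintro p q a h _ ⟨p', ⟨τ, r, helapse, hfire⟩, rfl⟩
    obtain ⟨τ', r', helapse', hr⟩ := exists_elapse_of_regionState_eq hT.pos h helapse
    obtain ⟨q', hfire', hq⟩ := hT.exists_fire_of_regionState_eq hr.symm hfire
    exact ⟨q', ⟨τ', r', helapse', hfire'⟩, hq⟩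
  · intro p q h hp
    have hloc : p.1 = q.1 := (Prod.ext_iff.1 h).1
    exact (congrArg (· ∈ T.accepting) hloc).mp hp

theorem outEdge_of_mem_step_regionNFA {A B : Type*} {T : TimedTransducer A B L X}
    {q q' : RegionState L X M} {b : B} (h : q' ∈ (regionNFA T d M).step q (.inr b)) :
    T.OutEdge q.1 q'.1 := by
  obtain ⟨p, rfl, p', ⟨τ, r, helapse, s, hs, hsource, hlabel, htarget, -⟩, rfl⟩ := h
  exact ⟨s, hs, hsource.trans helapse.1, htarget, b, hlabel⟩

end RegionAutomaton

section OutputBound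

theorem length_le_card_of_isChain {α : Type*} [Finite α] {E : α → α → Prop}
    (hE : ∀ a, ¬ Relation.TransGen E a a) {c : List α} (hc : c.IsChain E) :
    c.length ≤ Nat.card α := by
  have hpairwise : c.Pairwise (Relation.TransGen E) :=
    List.isChain_iff_pairwise.1 (hc.imp fun _ _ => .single)
  have hnodup : c.Nodup := hpairwise.imp fun h => by
    rintro rfl
    exact hE _ h
  have := Fintype.ofFinite α
  exact hnodup.length_le_card.trans_eq Nat.card_eq_fintype_card.symm

variable {A B Q L : Type*} {N : NFA (A ⊕ B) Q} {loc : Q → L} {E : L → L → Prop}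

theorem exists_isChain_of_mem_evalFrom
    (hN : ∀ q b, ∀ q' ∈ N.step q (.inr b), E (loc q) (loc q')) {q q' : Q} {u : List B}
    (h : q' ∈ N.evalFrom {q} (u.map .inr)) :
    ∃ c : List L, (loc q :: c).IsChain E ∧ c.length = u.length := by
  induction u generalizing q with
  | nil => exact ⟨[], .singleton _, rfl⟩
  | cons b u ih =>
    rw [List.map_cons, NFA.evalFrom_cons, NFA.stepSet_singleton, NFA.mem_evalFrom_iff_exists] at h
    obtain ⟨r, hr, h⟩ := h
    obtain ⟨c, hc, hlength⟩ := ih h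
    exact ⟨loc r :: c, hc.cons_cons (hN q b r hr), congrArg (· + 1) hlength⟩

theorem length_le_card_of_mem_evalFrom [Finite L] (hE : ∀ l, ¬ Relation.TransGen E l l)
    (hN : ∀ q b, ∀ q' ∈ N.step q (.inr b), E (loc q) (loc q')) {q q' : Q} {u : List B}
    (h : q' ∈ N.evalFrom {q} (u.map .inr)) : u.length ≤ Nat.card L := by
  obtain ⟨c, hc, hlength⟩ := exists_isChain_of_mem_evalFrom hN h
  have := length_le_card_of_isChain hE hc
  rw [List.length_cons] at this
  omega

end OutputBound

section Discretize

theorem card_length_le_le (B : Type*) [Fintype B] (k : ℕ) :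
    (List.finite_length_le B k).toFinset.card ≤ (Fintype.card B + 1) ^ k := by
  classical
  have hinj : InjOn (fun (u : List B) (i : Fin k) => u[(i : ℕ)]?)
      (List.finite_length_le B k).toFinset := by
    intro u hu v hv huv
    simp only [Finite.coe_toFinset, mem_ofPred_eq] at hu hv
    refine List.ext_getElem? fun i => ?_
    rcases lt_or_ge i k with hi | hi
    · exact congrFun huv ⟨i, hi⟩
    · rw [List.getElem?_eq_none (hu.trans hi), List.getElem?_eq_none (hv.trans hi)]
  calc _ ≤ (Finset.univ : Finset (Fin k → Option B)).card :=
        Finset.card_le_card_of_injOn _ (fun _ _ => Finset.mem_coe.2 (Finset.mem_univ _)) hinj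
    _ = _ := by simp

variable {A B Q : Type*}

theorem DiscreteTransducer.Run.output_eq_nil {D : DiscreteTransducer A B Q} {q q' : Q} {t : List B}
    (h : D.Run q [] t q') : t = [] := by
  cases h; rfl

variable [Fintype A] [Fintype Q]

open Classical in
/-- The discrete transducer whose transitions read one letter and write what `N` can write
immediately before and after reading it, up to total length `2 * k`. -/
noncomputable def discretize [Finite B] (N : NFA (A ⊕ B) Q) (k : ℕ) : DiscreteTransducer A B Q where
  initial := {q | q ∈ N.start}
  transitions := {e ∈ Finset.univ ×ˢ Finset.univ ×ˢ (List.finite_length_le B (2 * k)).toFinset ×ˢ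
      Finset.univ | ∃ u₁ u₂, e.2.2.1 = u₁ ++ u₂ ∧
        e.2.2.2 ∈ N.evalFrom {e.1} (u₁.map .inr ++ .inl e.2.1 :: u₂.map .inr)}
  accepting := {q | q ∈ N.accept}

variable {N : NFA (A ⊕ B) Q} {k : ℕ}

theorem mem_transitions_discretize [Finite B] {q q' : Q} {a : A} {w : List B} :
    (q, a, w, q') ∈ (discretize N k).transitions ↔ w.length ≤ 2 * k ∧ ∃ u₁ u₂, w = u₁ ++ u₂ ∧
      q' ∈ N.evalFrom {q} (u₁.map .inr ++ .inl a :: u₂.map .inr) := by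
  simp [discretize]

theorem mem_evalFrom_of_run_discretize [Finite B] {q q' : Q} {s : List A} {t : List B}
    (h : (discretize N k).Run q s t q') :
    ∃ z, q' ∈ N.evalFrom {q} z ∧ inputs z = s ∧ outputs z = t := by
  induction h with
  | nil => exact ⟨[], rfl, rfl, rfl⟩
  | @cons _ _ _ a _ _ _ htrans _ ih =>
    obtain ⟨-, u₁, u₂, rfl, hstep⟩ := mem_transitions_discretize.1 htrans
    obtain ⟨z, hz, rfl, rfl⟩ := ih
    refine ⟨u₁.map .inr ++ .inl a :: u₂.map .inr ++ z, ?_, by simp, by simp⟩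
    rw [NFA.evalFrom_append, NFA.mem_evalFrom_iff_exists]
    exact ⟨_, hstep, hz⟩

theorem run_discretize_of_mem_evalFrom [Finite B]
    (hk : ∀ q q' (u : List B), q' ∈ N.evalFrom {q} (u.map .inr) → u.length ≤ k) {q q' : Q}
    {u : List B} {z : List (A ⊕ B)} (h : q' ∈ N.evalFrom {q} (u.map .inr ++ z))
    (hz : inputs z ≠ []) : (discretize N k).Run q (inputs z) (u ++ outputs z) q' := by
  induction z generalizing q u with
  | nil => exact absurd rfl hz
  | cons c z ih =>
    cases c with
    | inr b => simpa using ih (u := u ++ [b]) (by simpa using h) hz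
    | inl a =>
      obtain ⟨r, hr, h'⟩ :
          ∃ r ∈ N.evalFrom {q} (u.map .inr), q' ∈ N.evalFrom {r} (.inl a :: z) := by
        rwa [NFA.evalFrom_append, NFA.mem_evalFrom_iff_exists] at h
      obtain ⟨r', hr', h'⟩ : ∃ r' ∈ N.step r (.inl a), q' ∈ N.evalFrom {r'} z := by
        rwa [NFA.evalFrom_cons, NFA.stepSet_singleton, NFA.mem_evalFrom_iff_exists] at h'
      have hu := hk q r u hr
      rcases eq_or_ne (inputs z) [] with hlast | hmore
      · -- No input letter is left to account for later outputs: the last transition writes them.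
        obtain ⟨v, rfl⟩ : ∃ v : List B, z = v.map .inr :=
          ⟨_, (map_inr_outputs_of_inputs_eq_nil hlast).symm⟩
        have hv := hk r' q' v h'
        have hlength : (u ++ v).length ≤ 2 * k := by rw [List.length_append]; omega
        simpa using DiscreteTransducer.Run.cons
          (mem_transitions_discretize.2 ⟨hlength, u, v, rfl, h⟩) (.nil q')
      · refine .cons (mem_transitions_discretize.2 ⟨by omega, u, [], by simp, ?_⟩)
          (ih (u := []) h' hmore)
        rw [NFA.evalFrom_append, NFA.mem_evalFrom_iff_exists]
        exact ⟨r, hr, by simpa using hr'⟩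

theorem relation_discretize [Finite B]
    (hk : ∀ q q' (u : List B), q' ∈ N.evalFrom {q} (u.map .inr) → u.length ≤ k) :
    (discretize N k).relation = {st | st ∈ wordRel N.accepts ∧ (st.1 = [] → st.2 = [])} := by
  ext ⟨s, t⟩
  constructor
  · rintro ⟨q, hq, q', hq', hrun⟩
    obtain ⟨z, hz, hinputs, houtputs⟩ := mem_evalFrom_of_run_discretize hrun
    refine ⟨⟨z, ⟨q', by simpa [discretize] using hq', NFA.mem_evalFrom_iff_exists.2
      ⟨q, by simpa [discretize] using hq, hz⟩⟩, Prod.ext hinputs houtputs⟩, ?_⟩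
    rintro rfl
    exact hrun.output_eq_nil
  · rintro ⟨⟨z, ⟨q', hq', hz⟩, hst⟩, hnil⟩
    simp only [Prod.mk.injEq] at hst
    obtain ⟨rfl, rfl⟩ := hst
    obtain ⟨q, hq, hz⟩ := NFA.mem_evalFrom_iff_exists.1 hz
    refine ⟨q, by simpa [discretize] using hq, q', by simpa [discretize] using hq', ?_⟩
    by_cases hinputs : inputs z = []
    · have houtputs : outputs z = [] := hnil hinputs
      obtain rfl : z = [] := by
        rw [← map_inr_outputs_of_inputs_eq_nil hinputs, houtputs, List.map_nil]
      obtain rfl : q' = q := hz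
      exact .nil q'
    · exact run_discretize_of_mem_evalFrom hk (u := []) hz hinputs

theorem card_transitions_discretize_le [Fintype B] :
    (discretize N k).transitions.card ≤ Fintype.card Q * (Fintype.card A *
      ((Fintype.card B + 1) ^ (2 * k) * Fintype.card Q)) := by
  classical
  refine (Finset.card_filter_le _ _).trans ?_
  simp only [Finset.card_product, Finset.card_univ]
  gcongr
  exact card_length_le_le B (2 * k)

theorem size_discretize_le [Fintype B] :
    (discretize N k).size ≤ Fintype.card A + Fintype.card B + 3 * Fintype.card Q +
      Fintype.card Q * (Fintype.card A * ((Fintype.card B + 1) ^ (2 * k) * Fintype.card Q)) *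
        (3 + 2 * k) := by
  have hinitial := Finset.card_le_univ (discretize N k).initial
  have haccepting := Finset.card_le_univ (discretize N k).accepting
  have htransitions := (Finset.sum_le_card_nsmul (discretize N k).transitions
    (fun e => 3 + e.2.2.1.length) (3 + 2 * k) fun _ he =>
      Nat.add_le_add_left (mem_transitions_discretize.1 he).1 3).trans
    (Nat.mul_le_mul_right _ card_transitions_discretize_le)
  unfold DiscreteTransducer.size
  omega

end Discretize

section CommonDenominator

open TimedTransducer (guardSize)

variable {S A B L X : Type*}

/-- The product of the denominators of the constants of a clock constraint. -/
def Guard.denProd (g : Guard X) : ℕ := (g.map fun c => c.const.den).prod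

theorem Guard.denProd_pos (g : Guard X) : 0 < g.denProd :=
  List.prod_pos <| List.forall_mem_map.2 fun c _ => c.const.den_pos

theorem Guard.denProd_le (g : Guard X) : g.denProd ≤ 2 ^ guardSize g := by
  induction g with
  | nil => exact le_rfl
  | cons c g ih =>
    have hden : c.const.den ≤ 2 ^ (2 + (Nat.size c.const.num + Nat.size c.const.den)) :=
      (Nat.lt_size_self _).le.trans (Nat.pow_le_pow_right two_pos (by omega))
    simp only [denProd, guardSize, List.map_cons, List.prod_cons, List.sum_cons, pow_add _ (_ + _)]
    exact Nat.mul_le_mul hden ih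

theorem Guard.den_dvd_denProd {g : Guard X} {c : Atom X} (hc : c ∈ g) : c.const.den ∣ g.denProd :=
  List.dvd_prod (List.mem_map_of_mem (f := fun c => c.const.den) hc)

theorem Guard.num_le {g : Guard X} {c : Atom X} (hc : c ∈ g) : c.const.num ≤ 2 ^ guardSize g := by
  have hsize : 2 + (Nat.size c.const.num + Nat.size c.const.den) ≤ guardSize g :=
    List.single_le_sum (fun _ _ => Nat.zero_le _) _ (List.mem_map_of_mem hc)
  exact (Nat.lt_size_self _).le.trans (Nat.pow_le_pow_right two_pos (by omega))

/-- A common denominator of the constants of a timed automaton. -/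
def commonDen (T : TimedAutomaton S L X) : ℕ := ∏ s ∈ T.switches, s.guard.denProd

theorem commonDen_pos (T : TimedAutomaton S L X) : 0 < commonDen T :=
  Finset.prod_pos fun s _ => s.guard.denProd_pos

theorem den_dvd_commonDen {T : TimedAutomaton S L X} {s : Switch S L X} (hs : s ∈ T.switches)
    {c : Atom X} (hc : c ∈ s.guard) : c.const.den ∣ commonDen T :=
  (Guard.den_dvd_denProd hc).trans
    (Finset.dvd_prod_of_mem (fun s : Switch S L X => s.guard.denProd) hs)

variable [Fintype A] [Fintype B] [Fintype L] [Fintype X] {T : TimedTransducer A B L X}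

theorem sum_guardSize_le : ∑ s ∈ T.switches, guardSize s.guard ≤ T.size := by
  have := Finset.sum_le_sum (s := T.switches) fun s _ =>
    show guardSize s.guard ≤ 3 + guardSize s.guard + s.resets.card by omega
  unfold TimedTransducer.size
  omega

theorem commonDen_le : commonDen T ≤ 2 ^ T.size :=
  calc commonDen T ≤ ∏ s ∈ T.switches, 2 ^ guardSize s.guard :=
        Finset.prod_le_prod' fun s _ => s.guard.denProd_le
    _ = 2 ^ ∑ s ∈ T.switches, guardSize s.guard := Finset.prod_pow_eq_pow_sum _ _ _
    _ ≤ 2 ^ T.size := Nat.pow_le_pow_right two_pos sum_guardSize_le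

theorem num_le_two_pow_size {s : Switch (A ⊕ B) L X} (hs : s ∈ T.switches) {c : Atom X}
    (hc : c ∈ s.guard) : c.const.num ≤ 2 ^ T.size := by
  have hguard : guardSize s.guard ≤ ∑ s ∈ T.switches, guardSize s.guard :=
    Finset.single_le_sum (f := fun s : Switch (A ⊕ B) L X => guardSize s.guard)
      (fun _ _ => Nat.zero_le _) hs
  exact (Guard.num_le hc).trans (Nat.pow_le_pow_right two_pos (hguard.trans sum_guardSize_le))

theorem isScale_commonDen (T : TimedTransducer A B L X) :
    IsScale T (commonDen T) (2 ^ (2 * T.size)) where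
  pos := commonDen_pos T
  exists_nat s hs c hc := by
    obtain ⟨m, hm⟩ := den_dvd_commonDen hs hc
    have hm_le : m ≤ 2 ^ T.size :=
      (Nat.le_of_dvd (commonDen_pos T) (Dvd.intro_left _ hm.symm)).trans commonDen_le
    refine ⟨m * c.const.num, ?_, ?_⟩
    · rw [two_mul, pow_add]
      exact Nat.mul_le_mul hm_le (num_le_two_pow_size hs hc)
    · have hden : (c.const.den : ℝ≥0) * (c.const : ℝ≥0) = c.const.num := by
        exact_mod_cast congrArg (fun q : ℚ≥0 => (q : ℝ≥0)) (NNRat.den_mul_eq_num c.const)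
      rw [hm, Nat.cast_mul, Nat.cast_mul, ← hden]
      ring

end CommonDenominator

section TimedToDiscrete

open Polynomial in
/-- The exponent in the bound on the size of the discrete transducer of a timed transducer. -/
noncomputable def sizeBound : ℕ[X] := 3 + 2 * (X + (2 * X + 3) * X ^ 2) + X * (2 * X + 2)

theorem regionCount_le {N l x M : ℕ} (hl : l ≤ N) (hx : x + 1 ≤ N) (hM : M = 2 ^ (2 * N)) :
    l * (4 * M + 3) ^ ((x + 1) * (x + 1)) ≤ 2 ^ (N + (2 * N + 3) * N ^ 2) := by
  have hbase : 4 * M + 3 ≤ 2 ^ (2 * N + 3) := by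
    have : 1 ≤ M := hM ▸ Nat.one_le_two_pow
    rw [pow_add, ← hM]
    omega
  calc l * (4 * M + 3) ^ ((x + 1) * (x + 1))
      ≤ 2 ^ N * (2 ^ (2 * N + 3)) ^ (N * N) := by
        refine Nat.mul_le_mul (hl.trans Nat.lt_two_pow_self.le) ?_
        exact (Nat.pow_le_pow_left hbase _).trans
          (Nat.pow_le_pow_right (by positivity) (Nat.mul_le_mul hx hx))
    _ = 2 ^ (N + (2 * N + 3) * N ^ 2) := by rw [← pow_mul, ← pow_add, sq]

theorem size_bound_le_two_pow {N E a b n k : ℕ} (hN : a + b + k + 1 ≤ N) (hn : n ≤ 2 ^ E) :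
    a + b + 3 * n + n * (a * ((b + 1) ^ (2 * k) * n)) * (3 + 2 * k) ≤
      2 ^ (3 + 2 * E + N * (2 * N + 2)) := by
  have hN_lt : N < 2 ^ N := Nat.lt_two_pow_self
  have hwords : (b + 1) ^ (2 * k) ≤ (2 ^ N) ^ (2 * N) :=
    (Nat.pow_le_pow_left (by omega) _).trans (Nat.pow_le_pow_right (by positivity) (by omega))
  have hletters : 3 + 2 * k ≤ 2 ^ (N + 1) := by rw [pow_succ]; omega
  have hmono {i : ℕ} (hi : i ≤ 1 + 2 * E + N * (2 * N + 2)) :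
      2 ^ i ≤ 2 ^ (1 + 2 * E + N * (2 * N + 2)) :=
    Nat.pow_le_pow_right two_pos hi
  have halphabets : a + b ≤ 2 ^ (1 + 2 * E + N * (2 * N + 2)) :=
    (by omega : a + b ≤ 2 ^ N).trans (hmono (by nlinarith))
  have hstates : 3 * n ≤ 2 * 2 ^ (1 + 2 * E + N * (2 * N + 2)) := by
    have := hmono (i := 1 + E) (by nlinarith)
    rw [pow_add] at this
    omega
  have htransitions : n * (a * ((b + 1) ^ (2 * k) * n)) * (3 + 2 * k) ≤
      2 ^ (1 + 2 * E + N * (2 * N + 2)) :=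
    calc _ ≤ 2 ^ E * (2 ^ N * ((2 ^ N) ^ (2 * N) * 2 ^ E)) * 2 ^ (N + 1) := by
          gcongr
          omega
      _ = _ := by rw [← pow_mul]; simp only [← pow_add]; ring_nf
  rw [(by ring : 3 + 2 * E + N * (2 * N + 2) = 2 + (1 + 2 * E + N * (2 * N + 2))), pow_add]
  omega

theorem exists_discreteTransducer {A B L X : Type*} [Fintype A] [Fintype B] [Fintype L] [Fintype X]
    (T : TimedTransducer A B L X) (hT : T.NoOutputCycle) :
    ∃ (Q : Type) (_ : Fintype Q) (_ : Nonempty Q) (D : DiscreteTransducer A B Q),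
      D.size ≤ 2 ^ sizeBound.eval T.size ∧
      D.relation = {st | st ∈ untimedRel T.relation ∧ (st.1 = [] → st.2 = [])} := by
  let M := 2 ^ (2 * T.size)
  let R := RegionState L X M
  -- A copy of the region automaton in the universe `Type`.
  let e : Fin (Nat.card R) ≃ R := (Finite.equivFin R).symm
  let N := pullback (regionNFA T (commonDen T) M) e
  have haccepts : N.accepts = T.untimedNFA.accepts := by
    rw [(isScale_commonDen T).isFunctionalBisimulation_regionState.accepts_eq]
    exact (isFunctionalBisimulation_pullback (by simp) (by simp)).accepts_eq
  have : Nonempty R := ⟨regionState (commonDen T) M (T.start, fun _ => 0)⟩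
  refine ⟨Fin (Nat.card R), inferInstance, Fin.pos_iff_nonempty.1 Nat.card_pos,
    discretize N (Nat.card L), size_discretize_le.trans ?_, ?_⟩
  · have hcard : Nat.card R ≤ 2 ^ (T.size + (2 * T.size + 3) * T.size ^ 2) := by
      rw [card_regionState, Nat.card_eq_fintype_card, Nat.card_eq_fintype_card]
      refine regionCount_le ?_ ?_ rfl <;> (unfold TimedTransducer.size; omega)
    have heval : sizeBound.eval T.size = 3 + 2 * (T.size + (2 * T.size + 3) * T.size ^ 2) +
        T.size * (2 * T.size + 2) := by simp [sizeBound]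
    rw [heval, Fintype.card_fin]
    refine size_bound_le_two_pow ?_ hcard
    rw [Nat.card_eq_fintype_card]
    unfold TimedTransducer.size
    omega
  · rw [untimedRel_relation_eq_wordRel, ← haccepts]
    exact relation_discretize fun q q' u hu =>
      length_le_card_of_mem_evalFrom (loc := fun q => (e q).1) hT
        (fun _ _ _ => outEdge_of_mem_step_regionNFA) hu

end TimedToDiscrete

section ClockFree

variable {S A B L X P : Type*}

/-- A finite automaton as a timed automaton without clocks, started in `l₀`. -/
noncomputable def clockFree [Finite S] [Finite L] (N : NFA S L) (l₀ : L) :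
    TimedAutomaton S L Empty where
  start := l₀
  switches := (toFinite ((fun e : L × S × L => Switch.mk e.1 e.2.1 [] ∅ e.2.2) ''
    {e | e.2.2 ∈ N.step e.1 e.2.1})).toFinset
  accepting := (toFinite N.accept).toFinset

theorem mem_switches_clockFree [Finite S] [Finite L] {N : NFA S L} {l₀ : L}
    {s : Switch S L Empty} : s ∈ (clockFree N l₀).switches ↔
      ∃ l a l', l' ∈ N.step l a ∧ Switch.mk l a [] ∅ l' = s := by
  simp [clockFree]

theorem step_clockFree_iff [Finite S] [Finite L] {N : NFA S L} {l₀ : L} {τ : ℝ≥0} {a : S}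
    {q q' : L × (Empty → ℝ≥0)} : (clockFree N l₀).Step τ a q q' ↔ q'.1 ∈ N.step q.1 a := by
  constructor
  · rintro ⟨r, ⟨hloc, -⟩, s, hs, hsource, rfl, htarget, -⟩
    obtain ⟨l, a, l', hl', rfl⟩ := mem_switches_clockFree.1 hs
    rwa [← hloc, ← hsource, ← htarget]
  · intro h
    exact ⟨q, ⟨rfl, nofun⟩, _, mem_switches_clockFree.2 ⟨q.1, a, q'.1, h, rfl⟩, rfl, rfl, rfl,
      nofun, nofun⟩

theorem isFunctionalBisimulation_clockFree [Finite S] [Finite L] {N : NFA S L} {l₀ : L}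
    (hstart : N.start = {l₀}) :
    IsFunctionalBisimulation (clockFree N l₀).untimedNFA N Prod.fst where
  image_start := (image_singleton ..).trans hstart.symm
  image_step q a := by
    ext l
    constructor
    · rintro ⟨q', ⟨τ, h⟩, rfl⟩
      exact step_clockFree_iff.1 h
    · intro h
      exact ⟨(l, nofun), ⟨0, step_clockFree_iff.2 h⟩, rfl⟩
  preimage_accept := by
    ext q
    simp [clockFree, TimedAutomaton.untimedNFA]

theorem exists_mem_step_of_outEdge_clockFree [Finite A] [Finite B] [Finite L]
    {N : NFA (A ⊕ B) L} {l₀ l l' : L} (h : TimedTransducer.OutEdge (clockFree N l₀) l l') :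
    ∃ b, l' ∈ N.step l (.inr b) := by
  obtain ⟨s, hs, rfl, rfl, b, hb⟩ := h
  obtain ⟨l, a, l', hl', rfl⟩ := mem_switches_clockFree.1 hs
  obtain rfl : a = .inr b := hb
  exact ⟨b, hl'⟩

theorem noOutputCycle_of_rank {T : TimedTransducer A B L X} (rank : L → ℕ)
    (h : ∀ l l', T.OutEdge l l' → rank l' < rank l) : T.NoOutputCycle := by
  intro l hl
  have hrank : Relation.TransGen (· > ·) (rank l) (rank l) := hl.lift rank h
  rw [Relation.transGen_eq_self] at hrank
  exact lt_irrefl _ hrank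

theorem exists_timedTransducer_of_finite_closed [Finite A] [Finite B] {N : NFA (A ⊕ B) P} {p₀ : P}
    (hstart : N.start = {p₀}) {F : Set P} (hF : F.Finite) (hp₀ : p₀ ∈ F)
    (hclosed : ∀ p ∈ F, ∀ a, N.step p a ⊆ F) (rank : P → ℕ)
    (hrank : ∀ p b, ∀ p' ∈ N.step p (.inr b), rank p' < rank p) :
    ∃ (L X : Type) (_ : Fintype L) (_ : Fintype X) (T : TimedTransducer A B L X),
      T.NoOutputCycle ∧ untimedRel T.relation = wordRel N.accepts := by
  have := hF.to_subtype
  let e : Fin (Nat.card F) ≃ F := (Finite.equivFin F).symm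
  let i : Fin (Nat.card F) → P := Subtype.val ∘ e
  have hrange : range i = F := by
    rw [range_comp, e.surjective.range_eq, image_univ, Subtype.range_coe]
  have hstart' : (pullback N i).start = {e.symm ⟨p₀, hp₀⟩} := by
    ext j
    change i j ∈ N.start ↔ _
    rw [hstart, mem_singleton_iff, mem_singleton_iff, Equiv.eq_symm_apply, Subtype.ext_iff]
    rfl
  refine ⟨Fin (Nat.card F), Empty, inferInstance, inferInstance,
    clockFree (pullback N i) (e.symm ⟨p₀, hp₀⟩), noOutputCycle_of_rank (rank ∘ i) ?_, ?_⟩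
  · intro l l' h
    obtain ⟨b, hb⟩ := exists_mem_step_of_outEdge_clockFree h
    exact hrank _ b _ hb
  · have hbisim : IsFunctionalBisimulation (pullback N i) N i := by
      refine isFunctionalBisimulation_pullback ?_ fun j a => ?_
      · rwa [hrange, hstart, singleton_subset_iff]
      · rw [hrange]
        exact hclosed _ (e j).2 a
    rw [untimedRel_relation_eq_wordRel,
      (isFunctionalBisimulation_clockFree hstart').accepts_eq, hbisim.accepts_eq]

end ClockFree

section Unfolding

variable {A B Q : Type*} {D : DiscreteTransducer A B Q}

/-- The letter-by-letter moves of a discrete transducer: a state is paired with the output that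
remains to be written, and `none` stands for all initial states together. -/
inductive UnfoldStep (D : DiscreteTransducer A B Q) :
    Option (Q × List B) → A ⊕ B → Option (Q × List B) → Prop
  | start {q q' a u} : q ∈ D.initial → (q, a, u, q') ∈ D.transitions →
      UnfoldStep D none (.inl a) (some (q', u))
  | read {q q' a u} : (q, a, u, q') ∈ D.transitions →
      UnfoldStep D (some (q, [])) (.inl a) (some (q', u))
  | write {q b u} : UnfoldStep D (some (q, b :: u)) (.inr b) (some (q, u))

/-- The automaton of the letter-by-letter moves of a discrete transducer. -/
def unfolding (D : DiscreteTransducer A B Q) : NFA (A ⊕ B) (Option (Q × List B)) where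
  step o a := {o' | UnfoldStep D o a o'}
  start := {none}
  accept := {o | o.elim (∃ q ∈ D.initial, q ∈ D.accepting) fun p => p.1 ∈ D.accepting ∧ p.2 = []}

theorem mem_evalFrom_unfolding_cons {o o' : Option (Q × List B)} {c : A ⊕ B} {z : List (A ⊕ B)} :
    o' ∈ (unfolding D).evalFrom {o} (c :: z) ↔
      ∃ r, UnfoldStep D o c r ∧ o' ∈ (unfolding D).evalFrom {r} z := by
  rw [NFA.evalFrom_cons, NFA.stepSet_singleton, NFA.mem_evalFrom_iff_exists]
  rfl

theorem mem_evalFrom_unfolding_map_inr_append {o : Option (Q × List B)} {q : Q} {u : List B}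
    {z : List (A ⊕ B)} (h : o ∈ (unfolding D).evalFrom {some (q, [])} z) :
    o ∈ (unfolding D).evalFrom {some (q, u)} (u.map .inr ++ z) := by
  induction u with
  | nil => exact h
  | cons b u ih => exact mem_evalFrom_unfolding_cons.2 ⟨_, .write, ih⟩

theorem DiscreteTransducer.Run.exists_mem_evalFrom_unfolding {q q' : Q} {s : List A} {t : List B}
    (h : D.Run q s t q') :
    ∃ z, inputs z = s ∧ outputs z = t ∧
      some (q', []) ∈ (unfolding D).evalFrom {some (q, [])} z := by
  induction h with
  | nil q => exact ⟨[], rfl, rfl, rfl⟩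
  | @cons q q' q'' a w s t htrans _ ih =>
    obtain ⟨z, rfl, rfl, hz⟩ := ih
    exact ⟨.inl a :: (w.map .inr ++ z), by simp, by simp, mem_evalFrom_unfolding_cons.2
      ⟨_, .read htrans, mem_evalFrom_unfolding_map_inr_append hz⟩⟩

theorem exists_run_of_mem_evalFrom_unfolding {z : List (A ⊕ B)} {q : Q} {u : List B}
    {o : Option (Q × List B)} (ho : o ∈ (unfolding D).accept)
    (h : o ∈ (unfolding D).evalFrom {some (q, u)} z) :
    ∃ t, ∃ q' ∈ D.accepting, outputs z = u ++ t ∧ D.Run q (inputs z) t q' := by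
  induction z generalizing q u with
  | nil =>
    obtain rfl : o = some (q, u) := h
    obtain ⟨hq, rfl⟩ := ho
    exact ⟨[], q, hq, rfl, .nil q⟩
  | cons c z ih =>
    obtain ⟨r, hr, hz⟩ := mem_evalFrom_unfolding_cons.1 h
    cases hr with
    | @read _ _ _ v htrans =>
      obtain ⟨t, q', hq', ht, hrun⟩ := ih hz
      exact ⟨v ++ t, q', hq', ht, .cons htrans hrun⟩
    | write =>
      obtain ⟨t, q', hq', ht, hrun⟩ := ih hz
      exact ⟨t, q', hq', by simp [ht], hrun⟩

theorem wordRel_accepts_unfolding (D : DiscreteTransducer A B Q) :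
    wordRel (unfolding D).accepts = D.relation := by
  ext ⟨s, t⟩
  constructor
  · rintro ⟨z, ⟨o, ho, hz⟩, hst⟩
    obtain ⟨rfl, rfl⟩ := Prod.ext_iff.1 hst
    cases z with
    | nil =>
      obtain rfl : o = none := hz
      obtain ⟨q, hq, hq'⟩ := ho
      exact ⟨q, hq, q, hq', .nil q⟩
    | cons c z =>
      obtain ⟨r, hr, hz⟩ := mem_evalFrom_unfolding_cons.1 hz
      cases hr with
      | start hq htrans =>
        obtain ⟨t, q', hq', ht, hrun⟩ := exists_run_of_mem_evalFrom_unfolding ho hz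
        refine ⟨_, hq, q', hq', ?_⟩
        simp only [outputs_inl_cons, inputs_inl_cons, ht]
        exact .cons htrans hrun
  · rintro ⟨q, hq, q', hq', hrun⟩
    dsimp only at hrun
    cases hrun with
    | nil => exact ⟨[], ⟨none, ⟨q, hq, hq'⟩, rfl⟩, rfl⟩
    | @cons _ _ _ a w _ _ htrans hrun =>
      obtain ⟨z, rfl, rfl, hz⟩ := hrun.exists_mem_evalFrom_unfolding
      exact ⟨.inl a :: (w.map .inr ++ z), ⟨some (q', []), ⟨hq', rfl⟩, mem_evalFrom_unfolding_cons.2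
        ⟨_, .start hq htrans, mem_evalFrom_unfolding_map_inr_append hz⟩⟩, by simp⟩

theorem exists_finite_closed_unfolding [Finite B] [Finite Q] (D : DiscreteTransducer A B Q) :
    ∃ F : Set (Option (Q × List B)), F.Finite ∧ none ∈ F ∧
      ∀ o ∈ F, ∀ a, (unfolding D).step o a ⊆ F := by
  let k := D.transitions.sup fun e => e.2.2.1.length
  have hk {q q' a w} (h : (q, a, w, q') ∈ D.transitions) : w.length ≤ k :=
    Finset.le_sup (f := fun e : Q × A × List B × Q => e.2.2.1.length) h
  refine ⟨insert none (some '' (univ ×ˢ {w | w.length ≤ k})),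
    ((finite_univ.prod (List.finite_length_le B k)).image some).insert none, mem_insert .., ?_⟩
  rintro o ho a o' hstep
  cases hstep with
  | start _ htrans => exact .inr ⟨_, ⟨trivial, hk htrans⟩, rfl⟩
  | read htrans => exact .inr ⟨_, ⟨trivial, hk htrans⟩, rfl⟩
  | @write q b u =>
    have hlength : (b :: u).length ≤ k := by simpa using ho
    exact .inr ⟨(q, u), ⟨trivial, (Nat.le_succ _).trans hlength⟩, rfl⟩

theorem exists_timedTransducer [Finite A] [Finite B] [Finite Q] (D : DiscreteTransducer A B Q) :
    ∃ (L X : Type) (_ : Fintype L) (_ : Fintype X) (T : TimedTransducer A B L X),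
      T.NoOutputCycle ∧ untimedRel T.relation = D.relation := by
  obtain ⟨F, hF, hnone, hclosed⟩ := exists_finite_closed_unfolding D
  rw [← wordRel_accepts_unfolding D]
  refine exists_timedTransducer_of_finite_closed rfl hF hnone hclosed
    (fun o => o.elim 0 fun p => p.2.length) ?_
  rintro _ b _ ⟨⟩
  exact Nat.lt_succ_self _

end Unfolding

end TimedTransduction

theorem mainTheorem12 :
    (∃ p : Polynomial ℕ,
      ∀ (A B L X : Type*) [Fintype A] [Fintype B] [Fintype L] [Fintype X]
        (T : TimedTransduction.TimedTransducer A B L X), T.NoOutputCycle →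
        ∃ (Q : Type) (_ : Fintype Q) (_ : Nonempty Q)
          (D : TimedTransduction.DiscreteTransducer A B Q),
          D.size ≤ 2 ^ p.eval T.size ∧
          D.relation =
            {st | st ∈ TimedTransduction.untimedRel T.relation ∧ (st.1 = [] → st.2 = [])}) ∧
    (∀ (A B Q : Type*) [Fintype A] [Fintype B] [Fintype Q] [Nonempty Q]
        (D : TimedTransduction.DiscreteTransducer A B Q),
        ∃ (L X : Type) (_ : Fintype L) (_ : Fintype X)
          (T : TimedTransduction.TimedTransducer A B L X),
          T.NoOutputCycle ∧ TimedTransduction.untimedRel T.relation = D.relation) := by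
  exact ⟨⟨TimedTransduction.sizeBound, fun _ _ _ _ _ _ _ _ T hT =>
      TimedTransduction.exists_discreteTransducer T hT⟩,
    fun _ _ _ _ _ _ _ D => TimedTransduction.exists_timedTransducer D⟩
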